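/- Let $X$ be a Banach space over $\mathbb F\in\{\mathbb R,\mathbb C\}$, let $\mathcal B(X)$ be the algebra of bounded linear operators on $X$, and let $\mathcal A\subseteq\mathcal B(X)$ be a standard operator algebra, that is, an $\mathbb F$-subalgebra containing all bounded operators of finite rank; $\mathcal A$ need be neither unital nor norm closed. For $\xi\in\mathbb F$ put $[A,B]_\xi=AB-\xi BA$. Let $\xi\in\mathbb F$ and let $L:\mathcal A\to\mathcal B(X)$ be an additive $\xi$-Lie derivation, that is, an additive map with $$L([A,B]_\xi)=[L(A),B]_\xi+[A,L(B)]_\xi\qquad\text{for all }A,B\in\mathcal A .$$ An additive derivation $\tau:\mathcal A\to\mathcal B(X)$ is an additive map with $\tau(AB)=\tau(A)B+A\tau(B)$ for all $A,B\in\mathcal A$. Linearity over $\mathbb F$ and continuity are not assumed of any of these maps. 1. If $\xi=1$ and $\dim X\ge 3$, then there are an additive derivation $\tau:\mathcal A\to\mathcal B(X)$ and an additive map $h:\mathcal A\to\mathbb F$ with $h(AB-BA)=0$ for all $A,B\in\mathcal A$ such that $L(A)=\tau(A)+h(A)I$ for all $A\in\mathcal A$. 2. If $\xi=-1$, then $L$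 is an additive derivation. 3. If $\xi\ne 1$, $\xi\neq -1$ and $\dim X\neq 1$, then $L$ is an additive derivation and $L(\xi A)=\xi L(A)$ for all $A\in\mathcal A$. -/

import Mathlib

/-- The `ξ`-Lie product `[S, T]_ξ = S T - ξ T S` in a (not necessarily unital) algebra. -/
def xiLie {𝕜 R : Type*} [Field 𝕜] [NonUnitalRing R] [Module 𝕜 R] (ξ : 𝕜) (S T : R) : R :=
  S * T - ξ • (T * S)

/-- A (not necessarily unital or closed) subalgebra `A` of `B(X)` is a standard operator algebra
if it contains every bounded operator of finite rank. -/
def IsStandardOperatorAlgebra {𝕜 X : Type*} [RCLike 𝕜] [NormedAddCommGroup X] [NormedSpace 𝕜 X]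
    (A : NonUnitalSubalgebra 𝕜 (X →L[𝕜] X)) : Prop :=
  ∀ T : X →L[𝕜] X, FiniteDimensional 𝕜 (LinearMap.range (T : X →ₗ[𝕜] X)) → T ∈ A

/-- An additive map `L : A → B(X)` is an additive derivation. -/
def IsAdditiveDerivation {𝕜 X : Type*} [RCLike 𝕜] [NormedAddCommGroup X] [NormedSpace 𝕜 X]
    {A : NonUnitalSubalgebra 𝕜 (X →L[𝕜] X)} (L : A →+ (X →L[𝕜] X)) : Prop :=
  ∀ S T : A, L (S * T) = L S * (T : X →L[𝕜] X) + (S : X →L[𝕜] X) * L T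

/-- An additive map `L : A → B(X)` is an additive `ξ`-Lie derivation. -/
def IsAdditiveXiLieDerivation {𝕜 X : Type*} [RCLike 𝕜] [NormedAddCommGroup X] [NormedSpace 𝕜 X]
    {A : NonUnitalSubalgebra 𝕜 (X →L[𝕜] X)} (ξ : 𝕜) (L : A →+ (X →L[𝕜] X)) : Prop :=
  ∀ S T : A, L (xiLie ξ S T) =
    xiLie ξ (L S) (T : X →L[𝕜] X) + xiLie ξ (S : X →L[𝕜] X) (L T)

/-! Everything rests on rank one operators making `A` prime in `B(X)`: `U A V = 0` forces `U = 0` or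
`V = 0`. For `ξ² ≠ 1`, put `δ(S,T) = L(ST) - L(S)T - S L(T)` and `φ(S) = L(ξS) - ξL(S)`. The
hypothesis gives `(1-ξ²) δ(S,T) = φ(TS) + ξ φ(ST)`, whence `φ` is an `A`-bimodule map. As `δ` is a
Hochschild cocycle, `φ` kills double commutators, so these annihilate the values of `φ`. In
dimension at least 2 this gives `φ = 0`, hence `δ = 0` (`commutator_mul_scalarDefect`,
`eq_zero_of_commutator_mul`). For `ξ = -1`, `L` is a Jordan derivation, and the prime ring argument
of Herstein and Brešar applies (`leibnizDefect_mul_commutator`). For `ξ = 1`, fix a rank one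
idempotent `p` and correct `L` by an inner derivation so that `L(p)` is scalar. Then `L` respects
the Peirce decomposition of `p`, except that a diagonal element also acquires a scalar in the
opposite block. This scalar is `h`, and `L - hI` is a derivation (`leibniz_sub_trace`). Dimension 3
ensures that the corner of `1 - p` has nonscalar elements. -/

/-! ### Leibniz and scalar defects when `ξ² ≠ 1`. -/

section Prime

variable {k R : Type*} [Field k] [Ring R] [Algebra k R] {A : NonUnitalSubalgebra k R}

/-- `A` acts faithfully enough on `R` for the primeness condition `U A V = 0 → U = 0 ∨ V = 0`. -/
def ActsPrimely (A : NonUnitalSubalgebra k R) : Prop :=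
  ∀ U V : R, (∀ C : A, U * C * V = 0) → U = 0 ∨ V = 0

/-- The defect of the Leibniz rule for an additive map. -/
def leibnizDefect (L : A →+ R) (S T : A) : R := L (S * T) - L S * T - S * L T

lemma ActsPrimely.eq_zero_of_mul_right (hA : ActsPrimely A) {U : R}
    (h : ∀ C : A, U * C = 0) : U = 0 := by
  rcases hA U 1 (fun C => by rw [h C, zero_mul]) with h | h
  · exact h
  · rw [← mul_one U, h, mul_zero]

/-- Up to sign the defect is the Hochschild coboundary of `L`, hence a cocycle. -/
lemma leibnizDefect_cocycle (L : A →+ R) (S T U : A) :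
    S * leibnizDefect L T U - leibnizDefect L (S * T) U + leibnizDefect L S (T * U)
      - leibnizDefect L S T * U = 0 := by
  simp only [leibnizDefect, mul_assoc, NonUnitalSubalgebra.coe_mul]
  noncomm_ring

lemma leibnizDefect_add_right (L : A →+ R) (S T U : A) :
    leibnizDefect L S (T + U) = leibnizDefect L S T + leibnizDefect L S U := by
  simp only [leibnizDefect, mul_add, map_add, NonUnitalSubalgebra.coe_add]
  abel

/-- The failure of `L` to commute with multiplication by `ξ`. -/
def scalarDefect (ξ : k) (L : A →+ R) : A →+ R where
  toFun S := L (ξ • S) - ξ • L S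
  map_zero' := by simp
  map_add' S T := by simp only [smul_add, map_add]; abel

lemma scalarDefect_apply (ξ : k) (L : A →+ R) (S : A) :
    scalarDefect ξ L S = L (ξ • S) - ξ • L S := rfl

lemma leibnizDefect_eq {ξ : k} {L : A →+ R}
    (hL : ∀ S T : A, L (xiLie ξ S T) = xiLie ξ (L S) (T : R) + xiLie ξ (S : R) (L T)) (S T : A) :
    leibnizDefect L S T = scalarDefect ξ L (T * S) + ξ • leibnizDefect L T S := by
  have h := hL S T
  simp only [xiLie, map_sub] at h
  simp only [leibnizDefect, scalarDefect_apply]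
  rw [sub_eq_iff_eq_add] at h
  rw [h]
  module

/-- Substitute `leibnizDefect_eq` into itself with `S` and `T` exchanged. -/
lemma smul_leibnizDefect {ξ : k} {L : A →+ R}
    (hL : ∀ S T : A, L (xiLie ξ S T) = xiLie ξ (L S) (T : R) + xiLie ξ (S : R) (L T)) (S T : A) :
    (1 - ξ ^ 2) • leibnizDefect L S T
      = scalarDefect ξ L (T * S) + ξ • scalarDefect ξ L (S * T) := by
  have h1 := leibnizDefect_eq hL S T
  have h2 := leibnizDefect_eq hL T S
  rw [h2] at h1
  rw [sub_smul, one_smul]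
  nth_rewrite 1 [h1]
  module

lemma scalarDefect_mul_comm {ξ : k} (hξ : ξ ^ 2 ≠ 1) {L : A →+ R}
    (hL : ∀ S T : A, L (xiLie ξ S T) = xiLie ξ (L S) (T : R) + xiLie ξ (S : R) (L T)) (S T : A) :
    scalarDefect ξ L S * T = S * scalarDefect ξ L T := by
  -- By `smul_leibnizDefect` the defect depends only on the products `S * T` and `T * S`, so `ξ` may
  -- move from one factor to the other.
  have h : leibnizDefect L (ξ • S) T = leibnizDefect L S (ξ • T) := by
    have hc : (1 - ξ ^ 2) ≠ 0 := sub_ne_zero.2 hξ.symm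
    apply smul_right_injective R hc
    simp only [smul_leibnizDefect hL, smul_mul_assoc, mul_smul_comm]
  simp only [leibnizDefect, smul_mul_assoc, mul_smul_comm, NonUnitalSubalgebra.coe_smul] at h
  simp only [scalarDefect_apply, sub_mul, mul_sub, smul_mul_assoc, mul_smul_comm]
  have h' := sub_eq_zero.2 h
  rw [← sub_eq_zero, ← neg_eq_zero, ← h']
  abel

lemma scalarDefect_mul (hA : ActsPrimely A) {ξ : k} (hξ : ξ ^ 2 ≠ 1) {L : A →+ R}
    (hL : ∀ S T : A, L (xiLie ξ S T) = xiLie ξ (L S) (T : R) + xiLie ξ (S : R) (L T)) (S T : A) :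
    scalarDefect ξ L (S * T) = S * scalarDefect ξ L T := by
  rw [← sub_eq_zero]
  refine hA.eq_zero_of_mul_right fun C => ?_
  rw [sub_mul, mul_assoc, scalarDefect_mul_comm hξ hL (S * T) C,
    scalarDefect_mul_comm hξ hL T C, NonUnitalSubalgebra.coe_mul, mul_assoc, sub_self]

lemma commutator_mul_scalarDefect (hA : ActsPrimely A) {ξ : k} (hξ : ξ ^ 2 ≠ 1) {L : A →+ R}
    (hL : ∀ S T : A, L (xiLie ξ S T) = xiLie ξ (L S) (T : R) + xiLie ξ (S : R) (L T))
    (S T U V : A) :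
    (((S * U - U * S) * T - T * (S * U - U * S) : A) : R) * scalarDefect ξ L V = 0 := by
  have hl := scalarDefect_mul hA hξ hL
  have hr : ∀ S T : A, scalarDefect ξ L (S * T) = scalarDefect ξ L S * T := fun S T => by
    rw [hl, scalarDefect_mul_comm hξ hL]
  -- After scaling, every term of the cocycle identity is a value of the bimodule map `φ`; the terms
  -- carrying `ξ` cancel and leave `φ([[S,U],T]) = 0`.
  have h := congrArg (fun Z => (1 - ξ ^ 2) • Z) (leibnizDefect_cocycle L S T U)
  simp only [smul_sub, smul_add, smul_zero] at h
  rw [← mul_smul_comm, ← smul_mul_assoc] at h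
  simp only [smul_leibnizDefect hL] at h
  simp only [mul_add, add_mul, mul_smul_comm, smul_mul_assoc, ← hl, ← hr, mul_assoc] at h
  have h0 : scalarDefect ξ L ((S * U - U * S) * T - T * (S * U - U * S)) = 0 := by
    simp only [sub_mul, mul_sub, map_sub, mul_assoc]
    rw [← h]
    module
  rw [← hl, hr, h0, zero_mul]

lemma leibnizDefect_antisymm {L : A →+ R}
    (hL : ∀ S T : A, L (S * T + T * S) = L S * T + T * L S + (S * L T + L T * S)) (S T : A) :
    leibnizDefect L T S = - leibnizDefect L S T := by
  have h := hL S T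
  rw [map_add, ← eq_sub_iff_add_eq] at h
  simp only [leibnizDefect, h]
  abel

end Prime

/-! ### Jordan derivations of prime algebras. -/

section Jordan

variable {k R : Type*} [Field k] [CharZero k] [Ring R] [Algebra k R] {A : NonUnitalSubalgebra k R}

lemma eq_zero_of_add_self_eq_zero (k : Type*) {M : Type*} [Field k] [CharZero k] [AddCommGroup M]
    [Module k M] {x : M} (h : x + x = 0) : x = 0 := by
  rw [← two_smul k] at h
  exact (smul_eq_zero.1 h).resolve_left two_ne_zero

variable {L : A →+ R}

lemma jordan_triple
    (hL : ∀ S T : A, L (S * T + T * S) = L S * T + T * L S + (S * L T + L T * S)) (S T : A) :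
    L (S * T * S) = L S * T * S + S * L T * S + S * T * L S := by
  have h1 := hL S (S * T + T * S)
  have h2 := hL (S * S) T
  have h3 := hL S S
  have h4 := hL S T
  -- The triple product is a Jordan polynomial: with `S ∘ T = ST + TS`, `2 STS = S ∘ (S ∘ T) - S² ∘
  -- T`.
  have e : S * T * S + S * T * S
      = (S * (S * T + T * S) + (S * T + T * S) * S) - (S * S * T + T * (S * S)) := by noncomm_ring
  have e' := congrArg L e
  rw [map_sub, h1, h2, h4, map_add] at e'
  have e3 : L (S * S) = L S * S + S * L S := by
    rw [← sub_eq_zero]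
    apply eq_zero_of_add_self_eq_zero k
    rw [map_add] at h3
    rw [show ∀ a b : R, a - b + (a - b) = a + a - (b + b) by intros; abel, h3]
    abel
  rw [e3] at e'
  rw [← sub_eq_zero]
  apply eq_zero_of_add_self_eq_zero k
  rw [show ∀ a b : R, a - b + (a - b) = a + a - (b + b) by intros; abel, e']
  simp only [NonUnitalSubalgebra.coe_mul, NonUnitalSubalgebra.coe_add]
  noncomm_ring

lemma jordan_triple_add
    (hL : ∀ S T : A, L (S * T + T * S) = L S * T + T * L S + (S * L T + L T * S)) (S T U : A) :
    L (S * T * U + U * T * S) = L S * T * U + S * L T * U + S * T * L U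
      + (L U * T * S + U * L T * S + U * T * L S) := by
  have h := jordan_triple hL (S + U) T
  have e : S * T * U + U * T * S = (S + U) * T * (S + U) - S * T * S - U * T * U := by
    noncomm_ring
  rw [e, map_sub, map_sub, h, jordan_triple hL, jordan_triple hL, map_add]
  simp only [NonUnitalSubalgebra.coe_add]
  noncomm_ring

/-- Comes from computing `L` on `STCTS + TSCST = S(TCT)S + T(SCS)T` in two ways, by the polarized
triple rule on the left and by the iterated triple rule on the right. -/
lemma leibnizDefect_mul_commutator
    (hL : ∀ S T : A, L (S * T + T * S) = L S * T + T * L S + (S * L T + L T * S)) (S T C : A) :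
    leibnizDefect L S T * C * (S * T - T * S : R)
      = - ((S * T - T * S : R) * C * leibnizDefect L S T) := by
  have h1 := jordan_triple_add hL (S * T) C (T * S)
  have h2 := jordan_triple hL S (T * C * T)
  have h3 := jordan_triple hL T (S * C * S)
  rw [jordan_triple hL T C] at h2
  rw [jordan_triple hL S C] at h3
  have e : S * T * C * (T * S) + T * S * C * (S * T)
      = S * (T * C * T) * S + T * (S * C * S) * T := by noncomm_ring
  rw [e, map_add, h2, h3] at h1
  have h4 := leibnizDefect_antisymm hL S T
  have e1 : L (S * T) = leibnizDefect L S T + (L S * T + S * L T) := by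
    simp only [leibnizDefect]; abel
  have e2 : L (T * S) = - leibnizDefect L S T + (L T * S + T * L S) := by
    rw [← h4]; simp only [leibnizDefect]; abel
  rw [e1, e2] at h1
  rw [← sub_eq_zero] at h1 ⊢
  rw [← h1]
  simp only [NonUnitalSubalgebra.coe_mul]
  noncomm_ring

lemma leibnizDefect_eq_zero_of_not_commute (hA : ActsPrimely A)
    (hL : ∀ S T : A, L (S * T + T * S) = L S * T + T * L S + (S * L T + L T * S)) {S T : A}
    (hST : (S * T : R) - T * S ≠ 0) : leibnizDefect L S T = 0 := by
  have h := leibnizDefect_mul_commutator hL S T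
  -- With `K` the commutator and `D` the defect, moving `D` to either end gives `KCDEK = -KCKED` and
  -- `KCDEK = -DCKEK`. The two right sides are opposite, by the same relation applied to `CKE`.
  have key : ∀ C E : A, (S * T - T * S : R) * C * leibnizDefect L S T * E * (S * T - T * S : R)
      = 0 := by
    intro C E
    obtain ⟨F, hF⟩ : ∃ F : A, (F : R) = C * (S * T - T * S : R) * E :=
      ⟨C * (S * T - T * S) * E, by simp⟩
    have h1 := h F
    have h2 := h E
    have h3 := h C
    rw [hF] at h1
    generalize leibnizDefect L S T = D at *
    generalize (S * T - T * S : R) = K at *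
    apply eq_zero_of_add_self_eq_zero k
    have a1 : K * C * D * E * K = - (K * (C * K * E) * D) := by
      rw [mul_assoc, mul_assoc, ← mul_assoc D, h2]; noncomm_ring
    have a2 : K * C * D * E * K = - (D * (C * K * E) * K) := by
      rw [← neg_eq_iff_eq_neg.2 h3]; noncomm_ring
    nth_rewrite 1 [a1]
    rw [a2, ← h1]
    noncomm_ring
  have key2 : ∀ C : A, (S * T - T * S : R) * C * leibnizDefect L S T = 0 := fun C =>
    (hA _ _ (key C)).resolve_right hST
  exact (hA _ _ key2).resolve_left hST

/-- A Jordan derivation on a primely acting subalgebra is a derivation. -/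
lemma leibnizDefect_eq_zero_of_jordan (hA : ActsPrimely A)
    (hcomm : (∀ S T : A, (S * T : R) - T * S = 0) → ∀ (S : A) (T : R), S * T = T * S)
    (hL : ∀ S T : A, L (S * T + T * S) = L S * T + T * L S + (S * L T + L T * S)) (S T : A) :
    leibnizDefect L S T = 0 := by
  have noncentral : ∀ N : A, (∃ M : A, (N * M : R) - M * N ≠ 0) → ∀ T : A,
      leibnizDefect L N T = 0 := by
    rintro N ⟨M, hM⟩ T
    by_cases hT : (N * T : R) - T * N = 0
    -- If `T` commutes with `N`, then `T + M` does not, and the defect is additive in it.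
    · have h := leibnizDefect_eq_zero_of_not_commute hA hL (S := N) (T := T + M) (by
        rw [NonUnitalSubalgebra.coe_add,
          show (N * (T + M) : R) - (T + M) * N = (N * T - T * N) + (N * M - M * N) by noncomm_ring,
          hT, zero_add]
        exact hM)
      rwa [leibnizDefect_add_right, leibnizDefect_eq_zero_of_not_commute hA hL hM, add_zero] at h
    · exact leibnizDefect_eq_zero_of_not_commute hA hL hT
  by_cases hc : ∀ S T : A, (S * T : R) - T * S = 0
  · have h := hcomm hc
    have e := leibnizDefect_antisymm hL S T
    apply eq_zero_of_add_self_eq_zero k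
    -- In the commutative case the defect is symmetric as well as antisymmetric.
    nth_rewrite 1 [← neg_neg (leibnizDefect L S T), ← e]
    have hST : S * T = T * S := Subtype.ext (sub_eq_zero.1 (hc S T))
    simp only [leibnizDefect, hST, h T, h S]
    abel
  · push Not at hc
    obtain ⟨N, M, hNM⟩ := hc
    by_cases hT : ∃ M : A, (T * M : R) - M * T ≠ 0
    · rw [← neg_neg (leibnizDefect L S T), ← leibnizDefect_antisymm hL, noncentral T hT, neg_zero]
    · push Not at hT
      have h := noncentral (T + N) ⟨M, by
        rw [NonUnitalSubalgebra.coe_add,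
          show ((T + N) * M : R) - M * (T + N) = (T * M - M * T) + (N * M - M * N) by noncomm_ring,
          hT, zero_add]
        exact hNM⟩ S
      rw [leibnizDefect_antisymm hL, leibnizDefect_add_right, leibnizDefect_antisymm hL N,
        noncentral N ⟨M, hNM⟩, neg_zero, add_zero, neg_eq_zero] at h
      exact h

end Jordan

/-! ### Peirce decomposition along an idempotent and its complement. -/

section Peirce

variable {k R : Type*} [Field k] [Ring R] [Algebra k R]

/-- A pair of complementary idempotents of `R` (indexed by `Bool`) multiplying `A` into itself. -/
structure IsPeircePair (A : NonUnitalSubalgebra k R) (E : Bool → R) : Prop where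
  orth : ∀ i, E i * E (!i) = 0
  sum : ∀ i, E i + E (!i) = 1
  ne_zero : ∀ i, E i ≠ 0
  left_mem : ∀ i, ∀ S ∈ A, E i * S ∈ A
  right_mem : ∀ i, ∀ S ∈ A, S * E i ∈ A

/-- The Peirce corner `E i R E j`. -/
def InCorner (E : Bool → R) (i j : Bool) (T : R) : Prop := E i * T = T ∧ T * E j = T

variable {A : NonUnitalSubalgebra k R} {E : Bool → R}

namespace IsPeircePair

lemma idem (hE : IsPeircePair A E) (i : Bool) : E i * E i = E i := by
  have h := congrArg (E i * ·) (hE.sum i)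
  simpa [mul_add, hE.orth i] using h

lemma orth' (hE : IsPeircePair A E) (i : Bool) : E (!i) * E i = 0 := by
  simpa using hE.orth (!i)

lemma orth_of_ne (hE : IsPeircePair A E) {i j : Bool} (h : i ≠ j) : E i * E j = 0 := by
  obtain rfl : j = !i := by cases i <;> cases j <;> simp_all
  exact hE.orth i

/-- The `(i, j)` Peirce component of an element of `A`. -/
def comp (hE : IsPeircePair A E) (i j : Bool) (S : A) : A :=
  ⟨E i * S * E j, hE.right_mem j _ (hE.left_mem i _ S.2)⟩

lemma coe_comp (hE : IsPeircePair A E) (i j : Bool) (S : A) :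
    (hE.comp i j S : R) = E i * S * E j := rfl

lemma inCorner_sandwich (hE : IsPeircePair A E) (i j : Bool) (T : R) :
    InCorner E i j (E i * T * E j) :=
  ⟨by rw [mul_assoc, ← mul_assoc, hE.idem], by rw [mul_assoc, hE.idem]⟩

lemma comp_inCorner (hE : IsPeircePair A E) (i j : Bool) (S : A) :
    InCorner E i j (hE.comp i j S : R) := hE.inCorner_sandwich i j S

lemma sum_comp (hE : IsPeircePair A E) (S : A) :
    S = hE.comp true true S + hE.comp true false S + hE.comp false true S
      + hE.comp false false S := by
  apply Subtype.ext
  simp only [NonUnitalSubalgebra.coe_add, coe_comp]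
  have h : E true + E false = 1 := hE.sum true
  calc (S : R) = (E true + E false) * S * (E true + E false) := by rw [h, one_mul, mul_one]
    _ = _ := by noncomm_ring

end IsPeircePair

namespace InCorner

lemma mul_eq_zero (hE : IsPeircePair A E) {i j l m : Bool} (hjl : j ≠ l) {S T : R}
    (hS : InCorner E i j S) (hT : InCorner E l m T) : S * T = 0 := by
  rw [← hS.2, ← hT.1, mul_assoc, ← mul_assoc (E j), hE.orth_of_ne hjl, zero_mul, mul_zero]

lemma mul {i j l m : Bool} {S T : R}
    (hS : InCorner E i j S) (hT : InCorner E l m T) : InCorner E i m (S * T) :=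
  ⟨by rw [← mul_assoc, hS.1], by rw [mul_assoc, hT.2]⟩

lemma left_zero (hE : IsPeircePair A E) {i j l : Bool} (h : l ≠ i) {S : R}
    (hS : InCorner E i j S) : E l * S = 0 := by
  rw [← hS.1, ← mul_assoc, hE.orth_of_ne h, zero_mul]

lemma right_zero (hE : IsPeircePair A E) {i j l : Bool} (h : j ≠ l) {S : R}
    (hS : InCorner E i j S) : S * E l = 0 := by
  rw [← hS.2, mul_assoc, hE.orth_of_ne h, mul_zero]

end InCorner

/-- An additive map compatible with Peirce corners is a derivation once it is so on corners. -/
lemma leibniz_of_corners (hE : IsPeircePair A E) {τ : A →+ R}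
    (hτ : ∀ i j, ∀ S : A, InCorner E i j S → InCorner E i j (τ S))
    (h : ∀ i j l, ∀ S T : A, InCorner E i j S → InCorner E j l T →
      τ (S * T) = τ S * T + S * τ T) (S T : A) :
    τ (S * T) = τ S * T + S * τ T := by
  have h' : ∀ i j l m, ∀ S T : A, InCorner E i j S → InCorner E l m T →
      τ (S * T) = τ S * T + S * τ T := by
    intro i j l m S T hS hT
    by_cases hjl : j = l
    · subst hjl
      exact h i j m S T hS hT
    · have : S * T = 0 := Subtype.ext (hS.mul_eq_zero hE hjl hT)
      rw [this, map_zero, (hτ _ _ S hS).mul_eq_zero hE hjl hT,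
        hS.mul_eq_zero hE hjl (hτ _ _ T hT), add_zero]
  have additive : ∀ {S₁ S₂ T : A}, τ (S₁ * T) = τ S₁ * T + S₁ * τ T →
      τ (S₂ * T) = τ S₂ * T + S₂ * τ T →
      τ ((S₁ + S₂) * T) = τ (S₁ + S₂) * T + (S₁ + S₂ : A) * τ T := by
    intro S₁ S₂ T h₁ h₂
    rw [add_mul, map_add, map_add, h₁, h₂, NonUnitalSubalgebra.coe_add]
    noncomm_ring
  have additive' : ∀ {S T₁ T₂ : A}, τ (S * T₁) = τ S * T₁ + S * τ T₁ →
      τ (S * T₂) = τ S * T₂ + S * τ T₂ →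
      τ (S * (T₁ + T₂)) = τ S * (T₁ + T₂ : A) + S * τ (T₁ + T₂) := by
    intro S T₁ T₂ h₁ h₂
    rw [mul_add, map_add, map_add, h₁, h₂, NonUnitalSubalgebra.coe_add]
    noncomm_ring
  have corner_left : ∀ i j, ∀ S T : A, InCorner E i j S → τ (S * T) = τ S * T + S * τ T := by
    intro i j S T hS
    rw [hE.sum_comp T]
    exact additive' (additive' (additive' (h' _ _ _ _ _ _ hS (hE.comp_inCorner _ _ _))
      (h' _ _ _ _ _ _ hS (hE.comp_inCorner _ _ _)))
      (h' _ _ _ _ _ _ hS (hE.comp_inCorner _ _ _))) (h' _ _ _ _ _ _ hS (hE.comp_inCorner _ _ _))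
  rw [hE.sum_comp S]
  exact additive (additive (additive (corner_left _ _ _ _ (hE.comp_inCorner _ _ _))
    (corner_left _ _ _ _ (hE.comp_inCorner _ _ _)))
    (corner_left _ _ _ _ (hE.comp_inCorner _ _ _))) (corner_left _ _ _ _ (hE.comp_inCorner _ _ _))

/-- The Leibniz rule on the product of two elements of the same diagonal corner follows from the
rules for products with an off-diagonal corner. -/
lemma leibniz_diag (hA : ActsPrimely A) (hE : IsPeircePair A E) {τ : A →+ R}
    (hτ : ∀ i j, ∀ S : A, InCorner E i j S → InCorner E i j (τ S)) {i : Bool}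
    (h : ∀ S T : A, InCorner E i i S → InCorner E i (!i) T → τ (S * T) = τ S * T + S * τ T)
    {S T : A} (hS : InCorner E i i S) (hT : InCorner E i i T) :
    τ (S * T) = τ S * T + S * τ T := by
  -- Expanding `τ` on `(S * T) * U` and `S * (T * U)`, with `U` off-diagonal, shows that the defect
  -- annihilates `U`; primeness then removes it.
  have key : ∀ C : A, (τ (S * T) - (τ S * T + S * τ T)) * E i * C * E (!i) = 0 := by
    intro C
    have hU := hE.comp_inCorner i (!i) C
    have h1 := h (S * T) (hE.comp i (!i) C) (hS.mul hT) hU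
    have h2 := h S (T * hE.comp i (!i) C) hS (hT.mul hU)
    rw [← mul_assoc, h1, h T _ hT hU] at h2
    simp only [NonUnitalSubalgebra.coe_mul] at h2
    have h3 := sub_eq_zero.2 h2
    calc _ = (τ (S * T) - (τ S * T + S * τ T)) * (hE.comp i (!i) C : R) := by
          rw [hE.coe_comp]; noncomm_ring
      _ = _ := by rw [← h3]; noncomm_ring
  have h0 := (hA _ _ key).resolve_right (hE.ne_zero _)
  rw [← sub_eq_zero, ← h0, sub_mul, add_mul, mul_assoc, mul_assoc, (hτ _ _ _ (hS.mul hT)).2, hT.2,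
    (hτ _ _ _ hT).2]

end Peirce

/-! ### Lie derivations and the central trace. -/

section Lie

variable {k R : Type*} [Field k] [Ring R] [Algebra k R]
  {A : NonUnitalSubalgebra k R} {E : Bool → R} {L : A →+ R}

/-- `L` is an additive Lie derivation from `A` to `R`. -/
def IsLieDerivation (L : A →+ R) : Prop :=
  ∀ S T : A, L (S * T - T * S) = (L S * T - T * L S) + (S * L T - L T * S)

/-- The inner derivation `S ↦ D S - S D` on `A`. -/
def innerDer (A : NonUnitalSubalgebra k R) (D : R) : A →+ R where
  toFun S := D * S - S * D
  map_zero' := by simp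
  map_add' S T := by rw [NonUnitalSubalgebra.coe_add]; noncomm_ring

lemma innerDer_apply (D : R) (S : A) : innerDer A D S = D * S - S * D := rfl

lemma IsLieDerivation.add_innerDer (hL : IsLieDerivation L) (D : R) :
    IsLieDerivation (L + innerDer A D) := by
  intro S T
  simp only [AddMonoidHom.add_apply, hL S T, innerDer_apply, NonUnitalSubalgebra.coe_mul,
    NonUnitalSubalgebra.coe_sub]
  noncomm_ring

variable {p : A}

/-- A Lie derivation whose value at `p` commutes with `p` has central value at `p`, if the corner
of `p` consists of scalars. -/
lemma IsLieDerivation.scalar_of_commute (hA : ActsPrimely A) (hE : IsPeircePair A E)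
    (hp : E true = p) (hL : IsLieDerivation L) (hcomm : (p : R) * L p = L p * p)
    {a : k} (ha : (p : R) * L p * p = a • (p : R)) : L p = a • (1 : R) := by
  have hpp : (p : R) * p = p := by rw [← hp]; exact hE.idem true
  have hpd : (p : R) * (L p - a • 1) = 0 := by
    rw [mul_sub, sub_eq_zero, mul_smul_comm, mul_one, ← ha, mul_assoc, ← hcomm, ← mul_assoc, hpp]
  have hdp : (L p - a • 1) * (p : R) = 0 := by
    rw [sub_mul, sub_eq_zero, smul_mul_assoc, one_mul, ← ha, hcomm, mul_assoc, hpp]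
  -- The corner element `S = p C (1 - p)` satisfies `[p, S] = S`. Applying `L` and sandwiching
  -- between `p` and `1 - p` shows that `L p` commutes with `S`, so `S (L p - a) = (L p - a) p S =
  -- 0`.
  have key : ∀ C : A, (p : R) * C * (E false * (L p - a • 1)) = 0 := by
    intro C
    obtain ⟨h1, h2⟩ := hE.comp_inCorner true false C
    have h3 : (hE.comp true false C : R) * p = 0 := by
      rw [← hp, hE.coe_comp, mul_assoc, ← Bool.not_true, hE.orth' true, mul_zero]
    rw [hp] at h1
    have e : p * hE.comp true false C - hE.comp true false C * p = hE.comp true false C := by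
      apply Subtype.ext
      simp only [NonUnitalSubalgebra.coe_mul, NonUnitalSubalgebra.coe_sub, h1, h3, sub_zero]
    have h4 := hL p (hE.comp true false C)
    rw [e] at h4
    have h5 : (hE.comp true false C : R) = p * C * E false := by rw [hE.coe_comp, hp]
    generalize hE.comp true false C = S at *
    have hpE : (p : R) * E false = 0 := by rw [← hp]; exact hE.orth true
    have h6 := congrArg (fun Z => (p : R) * Z * E false) h4
    have h7 : (p : R) * (L p * S - S * L p) * E false = 0 := by
      have e1 : (p : R) * (p * L S - L S * p) * E false = p * L S * E false := by
        calc _ = (p * p : R) * L S * E false - p * L S * (p * E false) := by noncomm_ring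
          _ = _ := by rw [hpp, hpE, mul_zero, sub_zero]
      simp only [mul_add, add_mul] at h6
      rw [e1] at h6
      simpa using h6
    have hdE : L p * E false = E false * L p := by
      have hs := hE.sum true
      rw [hp, ← eq_sub_iff_add_eq'] at hs
      rw [Bool.not_true] at hs
      rw [hs, mul_sub, sub_mul, hcomm, mul_one, one_mul]
    have h8 : L p * S = S * L p := by
      rw [← sub_eq_zero, ← h7]
      calc L p * S - S * L p = L p * (p * S) * E false - p * S * (E false * L p) := by
            rw [h1, mul_assoc, h2, ← mul_assoc, h2]
        _ = (L p * p) * S * E false - p * S * (L p * E false) := by rw [hdE]; noncomm_ring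
        _ = _ := by rw [← hcomm]; noncomm_ring
    calc (p : R) * C * (E false * (L p - a • 1)) = S * (L p - a • 1) := by
          rw [h5, mul_assoc, mul_assoc, mul_assoc]
      _ = (L p - a • 1) * (p * S) := by
          rw [h1, mul_sub, sub_mul, h8]
          simp
      _ = 0 := by rw [← mul_assoc, hdp, zero_mul]
  have hp0 : (p : R) ≠ 0 := by rw [← hp]; exact hE.ne_zero true
  have h0 := (hA _ _ key).resolve_left hp0
  have hs := hE.sum true
  rw [hp, Bool.not_true] at hs
  calc L p = (p + E false) * (L p - a • 1) + a • 1 := by rw [hs, one_mul, sub_add_cancel]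
    _ = a • 1 := by rw [add_mul, hpd, h0, add_zero, zero_add]

/-- The inner derivation that makes a Lie derivation take a value commuting with `p` at `p`. -/
lemma commute_add_innerDer (hpp : (p : R) * p = p) (L : A →+ R) :
    (p : R) * (L + innerDer A (p * L p * (1 - p) - (1 - p) * L p * p)) p
      = (L + innerDer A (p * L p * (1 - p) - (1 - p) * L p * p)) p * p := by
  simp only [AddMonoidHom.add_apply, innerDer_apply]
  have h : ∀ x : R, (p : R) * (p * x) = p * x := fun x => by rw [← mul_assoc, hpp]
  simp only [mul_add, add_mul, mul_sub, sub_mul, mul_one, one_mul, mul_assoc, hpp, h]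
  abel

namespace IsLieDerivation

lemma bracket_idem (hp : E true = p) (hL : IsLieDerivation L) {a : k}
    (ha : L p = a • (1 : R)) (S : A) :
    L (p * S - S * p) = E true * L S - L S * E true := by
  rw [hL, ha, hp]
  simp

/-- The off-diagonal corners are the eigenspaces of `[p, ·]` for `1` and `-1`, and `L` commutes with
`[p, ·]` because `L p` is scalar. -/
lemma inCorner_offDiag [CharZero k] (hE : IsPeircePair A E) (hp : E true = p) (hL : IsLieDerivation L) {a : k}
    (ha : L p = a • (1 : R)) {i : Bool} {S : A} (hS : InCorner E i (!i) S) :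
    InCorner E i (!i) (L S) := by
  have h := hL.bracket_idem hp ha S
  have hf : E false = 1 - E true := by
    rw [eq_sub_iff_add_eq']
    exact hE.sum true
  have hi := hE.idem true
  have hi' : ∀ x, E true * (E true * x) = E true * x := fun x => by rw [← mul_assoc, hi]
  cases i
  · have e : p * S - S * p = - S := by
      apply Subtype.ext
      simp only [NonUnitalSubalgebra.coe_sub, NonUnitalSubalgebra.coe_mul,
        NonUnitalSubalgebra.coe_neg, ← hp]
      rw [hS.left_zero hE (by decide : true ≠ false), zero_sub]
      exact congrArg Neg.neg hS.2
    rw [e, map_neg, neg_eq_iff_eq_neg, neg_sub] at h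
    generalize L S = Y at *
    have h1 : E true * Y * E true = E true * Y + E true * Y := by
      nth_rewrite 2 [h]
      simp only [mul_sub, hi', mul_assoc]
      abel
    have h2 : E true * Y * E true = 0 := by
      have := congrArg (· * E true) h1
      simp only [add_mul, mul_assoc, hi] at this
      rw [mul_assoc]
      simpa using this
    have h3 : E true * Y = 0 := eq_zero_of_add_self_eq_zero k (by rw [← h1, h2])
    rw [h3, sub_zero] at h
    refine ⟨?_, h.symm⟩
    rw [hf, sub_mul, h3, one_mul, sub_zero]
  · have e : p * S - S * p = S := by
      apply Subtype.ext
      simp only [NonUnitalSubalgebra.coe_sub, NonUnitalSubalgebra.coe_mul, ← hp]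
      rw [hS.right_zero hE (by decide : (!true) ≠ true), hS.1, sub_zero]
    rw [e] at h
    generalize L S = Y at *
    have h1 : E true * Y * E true = Y * E true + Y * E true := by
      nth_rewrite 2 [h]
      simp only [sub_mul, mul_assoc, hi]
      rw [← mul_assoc, h]
      simp only [sub_mul, mul_sub, mul_assoc, hi, hi']
      abel
    have h2 : E true * Y * E true = 0 := by
      have := congrArg (E true * ·) h1
      simp only [mul_add, ← mul_assoc, hi] at this
      simpa using this
    have h3 : Y * E true = 0 := eq_zero_of_add_self_eq_zero k (by rw [← h1, h2])
    rw [h3, sub_zero] at h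
    refine ⟨h.symm, ?_⟩
    rw [Bool.not_true, hf, mul_sub, h3, mul_one, sub_zero]

/-- Diagonal elements lie in the kernel of `[p, ·]`, which `L` preserves. -/
lemma commute_of_diag (hE : IsPeircePair A E) (hp : E true = p) (hL : IsLieDerivation L) {a : k}
    (ha : L p = a • (1 : R)) {i : Bool} {S : A} (hS : InCorner E i i S) (j : Bool) :
    E j * L S = L S * E j := by
  have h := hL.bracket_idem hp ha S
  have e : p * S - S * p = 0 := by
    apply Subtype.ext
    simp only [NonUnitalSubalgebra.coe_sub, NonUnitalSubalgebra.coe_mul, ← hp,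
      NonUnitalSubalgebra.coe_zero]
    cases i
    · rw [hS.left_zero hE (by decide), hS.right_zero hE (by decide), sub_zero]
    · rw [hS.1, hS.2, sub_self]
  rw [e, map_zero, eq_comm, sub_eq_zero] at h
  cases j
  · have hf : E false = 1 - E true := by
      rw [eq_sub_iff_add_eq']
      exact hE.sum true
    rw [hf, sub_mul, mul_sub, h, one_mul, mul_one]
  · exact h

/-- The opposite diagonal block of the value at a diagonal element commutes with the opposite
diagonal corner of `A`. -/
lemma commute_opposite (hE : IsPeircePair A E) (hp : E true = p) (hL : IsLieDerivation L) {a : k}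
    (ha : L p = a • (1 : R)) {i : Bool} {S T : A} (hS : InCorner E i i S)
    (hT : InCorner E (!i) (!i) T) : L S * T = T * L S := by
  have h := hL S T
  have e : S * T - T * S = 0 := by
    apply Subtype.ext
    simp only [NonUnitalSubalgebra.coe_sub, NonUnitalSubalgebra.coe_mul,
      NonUnitalSubalgebra.coe_zero]
    rw [hS.mul_eq_zero hE (by simp) hT, hT.mul_eq_zero hE (by simp) hS, sub_zero]
  rw [e, map_zero] at h
  -- Multiplying by `E (!i)` kills `S * L T - L T * S`, since `L T` is block diagonal.
  have h' := congrArg (E (!i) * ·) h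
  simp only [mul_add, mul_sub, ← mul_assoc, mul_zero] at h'
  rw [hL.commute_of_diag hE hp ha hT, hS.left_zero hE (by simp), mul_assoc (L T),
    hS.left_zero hE (by simp), hL.commute_of_diag hE hp ha hS, mul_assoc (L S), hT.1] at h'
  simpa [sub_eq_zero] using h'.symm

/-- A Lie derivation, central at `p`, is a derivation up to a central trace, given the
trace on Peirce corners. -/
lemma leibniz_sub_trace [CharZero k] (hA : ActsPrimely A) (hE : IsPeircePair A E) (hp : E true = p)
    (hL : IsLieDerivation L) {a : k} (ha : L p = a • (1 : R)) {h : A →+ k}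
    (h_diag : ∀ i, ∀ S : A, InCorner E i i S → E (!i) * L S * E (!i) = h S • E (!i))
    (h_off : ∀ i, ∀ S : A, InCorner E i (!i) S → h S = 0)
    (h_nonscalar : ∃ C : A, ∀ a b : k, a • (E false * C * E false) = b • E false → a = 0)
    {τ : A →+ R} (hτ : ∀ S, L S = τ S + h S • (1 : R)) (S T : A) :
    τ (S * T) = τ S * T + S * τ T := by
  have hτ' : ∀ S, τ S = L S - h S • (1 : R) := fun S => by rw [hτ, add_sub_cancel_right]
  have off : ∀ i, ∀ S : A, InCorner E i (!i) S → InCorner E i (!i) (τ S) := by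
    intro i S hS
    rw [hτ', h_off i S hS, zero_smul, sub_zero]
    exact hL.inCorner_offDiag hE hp ha hS
  have diag : ∀ i, ∀ S : A, InCorner E i i S → InCorner E i i (τ S) := by
    intro i S hS
    have hc : ∀ j, E j * τ S = τ S * E j := fun j => by
      rw [hτ', mul_sub, sub_mul, hL.commute_of_diag hE hp ha hS]
      simp
    have h0 : E (!i) * τ S = 0 := by
      have h1 := h_diag i S hS
      rw [mul_assoc, ← hL.commute_of_diag hE hp ha hS, ← mul_assoc, hE.idem] at h1
      rw [hτ', mul_sub, h1, mul_smul_comm, mul_one, sub_self]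
    have h1 : E i * τ S = τ S := by
      have := hE.sum i
      nth_rewrite 2 [← one_mul (τ S)]
      rw [← this, add_mul, h0, add_zero]
    exact ⟨h1, by rw [← hc, h1]⟩
  have corner : ∀ i j, ∀ S : A, InCorner E i j S → InCorner E i j (τ S) := by
    intro i j S hS
    by_cases hij : i = j
    · subst hij
      exact diag i S hS
    · obtain rfl : j = !i := Bool.eq_not.2 (Ne.symm hij)
      exact off i S hS
  have bracket : ∀ S T : A, τ (S * T) - τ (T * S) + h (S * T - T * S) • (1 : R)
      = (τ S * T + S * τ T) - (τ T * S + T * τ S) := by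
    intro S T
    have e := hL S T
    rw [hτ, map_sub τ] at e
    rw [e, hτ S, hτ T]
    simp only [add_mul, mul_add, smul_mul_assoc, mul_smul_comm, one_mul, mul_one]
    abel
  have diag_off : ∀ i, ∀ S T : A, InCorner E i i S → InCorner E i (!i) T →
      τ (S * T) = τ S * T + S * τ T := by
    intro i S T hS hT
    have b := bracket S T
    have e : T * S = 0 := Subtype.ext (hT.mul_eq_zero hE (by simp) hS)
    rw [e, map_zero, sub_zero, sub_zero, h_off i _ (hS.mul hT), zero_smul, add_zero,
      (off i T hT).mul_eq_zero hE (by simp) hS, hT.mul_eq_zero hE (by simp) (diag i S hS)] at b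
    simpa using b
  have off_diag : ∀ i, ∀ S T : A, InCorner E i (!i) S → InCorner E (!i) (!i) T →
      τ (S * T) = τ S * T + S * τ T := by
    intro i S T hS hT
    have b := bracket S T
    have e : T * S = 0 := Subtype.ext (hT.mul_eq_zero hE (by simp) hS)
    rw [e, map_zero, sub_zero, sub_zero, h_off i _ (hS.mul hT), zero_smul, add_zero,
      (diag _ T hT).mul_eq_zero hE (by simp) hS, hT.mul_eq_zero hE (by simp) (off i S hS)] at b
    simpa using b
  have diag_diag : ∀ i, ∀ S T : A, InCorner E i i S → InCorner E i i T →
      τ (S * T) = τ S * T + S * τ T := fun i S T hS hT =>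
    leibniz_diag hA hE corner (diag_off i) hS hT
  -- This is the `i`-th diagonal block of `bracket`; `T * S` contributes only to the other block.
  have off_eq : ∀ i, ∀ S T : A, InCorner E i (!i) S → InCorner E (!i) i T →
      τ (S * T) - (τ S * T + S * τ T) = - h (S * T - T * S) • E i := by
    intro i S T hS hT
    have b := bracket S T
    have hT' : InCorner E (!i) (!!i) T := by simpa using hT
    have c1 : InCorner E i i (τ (S * T)) := diag i _ (hS.mul hT)
    have c2 : E i * τ (T * S) = 0 := (diag _ _ (hT.mul hS)).left_zero hE (by simp)
    have c3 : E i * τ S = τ S := (off i S hS).1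
    have c4 : E i * τ T = 0 := (off _ T hT').left_zero hE (by simp)
    have b' := congrArg (E i * ·) b
    simp only [mul_add, mul_sub, ← mul_assoc, c1.1, c2, c3, c4, hS.1,
      hT.left_zero hE (show i ≠ !i by simp), zero_mul, mul_smul_comm, mul_one, sub_zero,
      add_zero] at b'
    rw [← b', neg_smul]
    abel
  -- The defect of `(T, S * C)` is that of `(T, S)` times `C`, and both defects are multiples of `E
  -- false`. A nonscalar `C` forces the coefficient of the defect of `(T, S)` to vanish.
  have trace_zero : ∀ S T : A, InCorner E true false S → InCorner E false true T →
      h (S * T - T * S) = 0 := by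
    intro S T hS hT
    obtain ⟨C₀, hC₀⟩ := h_nonscalar
    obtain ⟨C, hC⟩ : ∃ C, C = hE.comp false false C₀ := ⟨_, rfl⟩
    have hCc : InCorner E false false C := by
      rw [hC]
      exact hE.comp_inCorner _ _ _
    have e1 := off_eq false T S hT hS
    have e2 := off_eq false T (S * C) hT (hS.mul hCc)
    have e3 := diag_diag false (T * S) C (hT.mul hS) hCc
    have e4 := off_diag true S C hS hCc
    rw [← mul_assoc, e3, e4] at e2
    rw [← neg_sub (T * S), map_neg, neg_eq_zero]
    apply hC₀ _ (h (T * (S * C) - S * C * T))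
    rw [← hE.coe_comp, ← hC]
    have e5 : (τ (T * S) - (τ T * S + T * τ S)) * C = -h (T * (S * C) - S * C * T) • E false := by
      rw [← mul_assoc T S C, ← e2]
      simp only [NonUnitalSubalgebra.coe_mul]
      noncomm_ring
    rw [e1, smul_mul_assoc, hCc.1, neg_smul, neg_smul, neg_inj] at e5
    exact e5
  refine leibniz_of_corners hE corner ?_ S T
  intro i j l S T hS hT
  by_cases hij : i = j
  · subst hij
    by_cases hil : i = l
    · subst hil
      exact diag_diag i S T hS hT
    · obtain rfl : l = !i := Bool.eq_not.2 (Ne.symm hil)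
      exact diag_off i S T hS hT
  · obtain rfl : j = !i := Bool.eq_not.2 (Ne.symm hij)
    by_cases hil : i = l
    · subst hil
      rw [← sub_eq_zero, off_eq i S T hS hT]
      cases i
      · rw [← neg_sub, map_neg, trace_zero T S hT hS]
        simp
      · rw [trace_zero S T hS hT]
        simp
    · obtain rfl : l = !i := Bool.eq_not.2 (Ne.symm hil)
      exact off_diag i S T hS hT

end IsLieDerivation

end Lie

/-! ### Standard operator algebras and their rank one operators. -/

namespace IsStandardOperatorAlgebra

variable {𝕜 X : Type*} [RCLike 𝕜] [NormedAddCommGroup X] [NormedSpace 𝕜 X]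
  {A : NonUnitalSubalgebra 𝕜 (X →L[𝕜] X)}

lemma rankOne_mem (hA : IsStandardOperatorAlgebra A) (f : X →L[𝕜] 𝕜) (x : X) :
    f.smulRight x ∈ A := by
  apply hA
  refine Submodule.finiteDimensional_of_le (S₂ := Submodule.span 𝕜 {x}) ?_
  rintro _ ⟨y, rfl⟩
  exact Submodule.smul_mem _ _ (Submodule.mem_span_singleton_self x)

lemma actsPrimely (hA : IsStandardOperatorAlgebra A) : ActsPrimely A := by
  intro U V h
  by_contra hUV
  push Not at hUV
  obtain ⟨x, hx⟩ := DFunLike.ne_iff.1 hUV.1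
  obtain ⟨y, hy⟩ := DFunLike.ne_iff.1 hUV.2
  obtain ⟨f, hf⟩ := SeparatingDual.exists_eq_one (R := 𝕜) hy
  have e := DFunLike.congr_fun (h ⟨_, hA.rankOne_mem f x⟩) y
  exact hx (by simpa [hf] using e)

/-- If `f x = 1`, commuting with the rank one operators `f ⊗ T x` and `f ⊗ x` makes `S` act on `T x`
and on `x` by the same scalar `f (S x)`. -/
lemma commute_of_commutative (hA : IsStandardOperatorAlgebra A)
    (h : ∀ S T : A, (S * T : X →L[𝕜] X) - T * S = 0) (S : A) (T : X →L[𝕜] X) :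
    S * T = T * S := by
  rw [← sub_eq_zero]
  ext x
  rcases eq_or_ne x 0 with rfl | hx
  · simp
  obtain ⟨f, hf⟩ := SeparatingDual.exists_eq_one (R := 𝕜) hx
  have e1 := DFunLike.congr_fun (h S ⟨_, hA.rankOne_mem f (T x)⟩) x
  have e2 := DFunLike.congr_fun (h S ⟨_, hA.rankOne_mem f x⟩) x
  simp only [sub_apply, mul_apply_eq_comp,
    ContinuousLinearMap.smulRight_apply, hf, one_smul, zero_apply,
    sub_eq_zero] at e1 e2 ⊢
  rw [e1, e2]
  simp [hf]

lemma exists_ker_ne_zero (h : 2 ≤ Module.rank 𝕜 X) (f : X →L[𝕜] 𝕜) : ∃ x ≠ 0, f x = 0 := by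
  by_contra! hc
  have hinj : Function.Injective (f : X →ₗ[𝕜] 𝕜) := by
    rw [injective_iff_map_eq_zero]
    intro x hx
    by_contra h0
    exact hc x h0 hx
  have := FiniteDimensional.of_injective _ hinj
  have hle := LinearMap.finrank_le_finrank_of_injective hinj
  rw [← Module.finrank_eq_rank] at h
  have h' : 2 ≤ Module.finrank 𝕜 X := by exact_mod_cast h
  rw [Module.finrank_self] at hle
  omega

lemma exists_ker_inf_ne_zero (h : 3 ≤ Module.rank 𝕜 X) (f g : X →L[𝕜] 𝕜) :
    ∃ x ≠ 0, f x = 0 ∧ g x = 0 := by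
  by_contra! hc
  have hinj : Function.Injective ((f.prod g : X →L[𝕜] 𝕜 × 𝕜) : X →ₗ[𝕜] 𝕜 × 𝕜) := by
    rw [injective_iff_map_eq_zero]
    intro x hx
    by_contra h0
    exact hc x h0 (congrArg Prod.fst hx) (congrArg Prod.snd hx)
  have := FiniteDimensional.of_injective _ hinj
  have hle := LinearMap.finrank_le_finrank_of_injective hinj
  rw [← Module.finrank_eq_rank] at h
  have h' : 3 ≤ Module.finrank 𝕜 X := by exact_mod_cast h
  rw [Module.finrank_prod, Module.finrank_self] at hle
  omega

lemma eq_zero_of_commutator_mul (hA : IsStandardOperatorAlgebra A) (h2 : 2 ≤ Module.rank 𝕜 X)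
    {Y : X →L[𝕜] X}
    (h : ∀ S T U : A, (((S * U - U * S) * T - T * (S * U - U * S) : A) : X →L[𝕜] X) * Y = 0) :
    Y = 0 := by
  ext v
  by_contra hv
  obtain ⟨f, hf⟩ := SeparatingDual.exists_eq_one (R := 𝕜) hv
  obtain ⟨x, hx0, hx⟩ := exists_ker_ne_zero h2 f
  obtain ⟨g, hg⟩ := SeparatingDual.exists_eq_one (R := 𝕜) hx0
  -- With `P = g ⊗ x` and `N = f ⊗ x`, `PN = N` and `NP = 0`, so the double commutator is `-N`,
  -- which sends `Y v` to `-x`.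
  have e := DFunLike.congr_fun (h ⟨_, hA.rankOne_mem g x⟩ ⟨_, hA.rankOne_mem g x⟩
    ⟨_, hA.rankOne_mem f x⟩) v
  simp [hf, hx, hg] at e
  exact hx0 e

/-- An additive `ξ`-Lie derivation with `ξ² ≠ 1` is a derivation commuting with `ξ`. -/
lemma derivation_of_sq_ne_one (hA : IsStandardOperatorAlgebra A) (h1 : Module.rank 𝕜 X ≠ 1)
    {ξ : 𝕜} (hξ : ξ ^ 2 ≠ 1) {L : A →+ (X →L[𝕜] X)} (hL : IsAdditiveXiLieDerivation ξ L) :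
    IsAdditiveDerivation L ∧ ∀ S : A, L (ξ • S) = ξ • L S := by
  have hφ : ∀ V, scalarDefect ξ L V = 0 := by
    intro V
    rcases le_or_gt 2 (Module.rank 𝕜 X) with h2 | h2
    · exact hA.eq_zero_of_commutator_mul h2 fun S T U =>
        commutator_mul_scalarDefect hA.actsPrimely hξ hL S T U V
    · have h0 : Module.rank 𝕜 X = 0 := by
        obtain ⟨n, hn⟩ := Cardinal.lt_aleph0.1 (h2.trans (Cardinal.natCast_lt_aleph0 (n := 2)))
        rw [hn] at h1 h2 ⊢
        norm_cast at h1 h2 ⊢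
        omega
      have := rank_zero_iff.1 h0
      exact Subsingleton.elim _ _
  refine ⟨fun S T => ?_, fun S => sub_eq_zero.1 (hφ S)⟩
  have h := smul_leibnizDefect hL S T
  rw [hφ, hφ, smul_zero, add_zero] at h
  have hD := (smul_eq_zero.1 h).resolve_left (sub_ne_zero.2 hξ.symm)
  rw [leibnizDefect, sub_sub] at hD
  exact sub_eq_zero.1 hD

lemma derivation_of_jordan (hA : IsStandardOperatorAlgebra A) {L : A →+ (X →L[𝕜] X)}
    (hL : IsAdditiveXiLieDerivation (-1) L) : IsAdditiveDerivation L := by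
  intro S T
  have hD := leibnizDefect_eq_zero_of_jordan hA.actsPrimely hA.commute_of_commutative
    (L := L) (fun S T => by simpa [xiLie] using hL S T) S T
  rw [leibnizDefect, sub_sub] at hD
  exact sub_eq_zero.1 hD

/-- The Peirce pair of a rank one idempotent. -/
def rankOnePair (f : X →L[𝕜] 𝕜) (x : X) : Bool → (X →L[𝕜] X)
  | true => f.smulRight x
  | false => 1 - f.smulRight x

lemma isPeircePair_rankOne (hA : IsStandardOperatorAlgebra A) {f : X →L[𝕜] 𝕜} {x y : X}
    (hfx : f x = 1) (hy : y ≠ 0) (hfy : f y = 0) : IsPeircePair A (rankOnePair f x) where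
  orth i := by cases i <;> ext z <;> simp [rankOnePair, hfx]
  sum i := by cases i <;> simp [rankOnePair]
  ne_zero i := by
    cases i
    · intro h
      exact hy (by simpa [rankOnePair, hfy] using DFunLike.congr_fun h y)
    · intro h
      have := congrArg f (DFunLike.congr_fun h x)
      simp [rankOnePair, hfx] at this
  left_mem i S hS := by
    cases i
    · simpa only [rankOnePair, sub_mul, one_mul] using
        sub_mem hS (mul_mem (hA.rankOne_mem f x) hS)
    · exact mul_mem (hA.rankOne_mem f x) hS
  right_mem i S hS := by
    cases i
    · simpa only [rankOnePair, mul_sub, mul_one] using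
        sub_mem hS (mul_mem hS (hA.rankOne_mem f x))
    · exact mul_mem hS (hA.rankOne_mem f x)

/-- An additive Lie derivation is a derivation plus a central trace in dimension at least three. -/
lemma exists_derivation_add_trace (hA : IsStandardOperatorAlgebra A) (h3 : 3 ≤ Module.rank 𝕜 X)
    {L : A →+ (X →L[𝕜] X)} (hL : IsLieDerivation L) :
    ∃ (τ : A →+ (X →L[𝕜] X)) (h : A →+ 𝕜), IsAdditiveDerivation τ ∧
      (∀ S T : A, h (S * T - T * S) = 0) ∧ ∀ S : A, L S = τ S + h S • (1 : X →L[𝕜] X) := by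
  obtain ⟨x₀, hx₀, -⟩ := exists_ker_inf_ne_zero h3 0 0
  obtain ⟨f₀, hf₀⟩ := SeparatingDual.exists_eq_one (R := 𝕜) hx₀
  obtain ⟨x₁, hx₁, hf₀₁, -⟩ := exists_ker_inf_ne_zero h3 f₀ 0
  obtain ⟨f₁, hf₁⟩ := SeparatingDual.exists_eq_one (R := 𝕜) hx₁
  obtain ⟨x₂, hx₂, hf₀₂, hf₁₂⟩ := exists_ker_inf_ne_zero h3 f₀ f₁
  have hE := hA.isPeircePair_rankOne hf₀ hx₁ hf₀₁
  obtain ⟨E, hEdef⟩ : ∃ E, E = rankOnePair f₀ x₀ := ⟨_, rfl⟩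
  have hEt : E true = f₀.smulRight x₀ := by rw [hEdef]; rfl
  have hEf : E false = 1 - f₀.smulRight x₀ := by rw [hEdef]; rfl
  rw [← hEdef] at hE
  obtain ⟨p, hp⟩ : ∃ p : A, E true = p := ⟨⟨_, hA.rankOne_mem f₀ x₀⟩, hEt⟩
  have hpp : (p : X →L[𝕜] X) * p = p := by rw [← hp]; exact hE.idem true
  have hscalar : ∀ T : X →L[𝕜] X, E true * T * E true = f₀ (T x₀) • E true := by
    intro T
    ext z
    simp [hEt, smul_smul, mul_comm]
  obtain ⟨D, hD⟩ : ∃ D, D = (p : X →L[𝕜] X) * L p * (1 - p) - (1 - p) * L p * p := ⟨_, rfl⟩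
  obtain ⟨M, hM⟩ : ∃ M, M = L + innerDer A D := ⟨_, rfl⟩
  have hMlie : IsLieDerivation M := by rw [hM]; exact hL.add_innerDer D
  have hMp : M p = f₀ (M p x₀) • (1 : X →L[𝕜] X) := by
    apply hMlie.scalar_of_commute hA.actsPrimely hE hp
    · rw [hM, hD]
      exact commute_add_innerDer hpp L
    · rw [← hp]
      exact hscalar _
  -- Each summand reads off the scalar in the block opposite to a diagonal component: on the range
  -- of `p` at `x₀`, on that of `1 - p` at `x₁`.
  obtain ⟨h, hh⟩ : ∃ h : A →+ 𝕜, ∀ S, h S =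
      f₀ (M (hE.comp false false S) x₀) + f₁ (M (hE.comp true true S) x₁) := by
    have hadd : ∀ i S T, hE.comp i i (S + T) = hE.comp i i S + hE.comp i i T := by
      intro i S T
      apply Subtype.ext
      simp only [IsPeircePair.coe_comp, NonUnitalSubalgebra.coe_add, mul_add, add_mul]
    refine ⟨AddMonoidHom.mk' (fun S => f₀ (M (hE.comp false false S) x₀)
      + f₁ (M (hE.comp true true S) x₁)) fun S T => ?_, fun S => rfl⟩
    simp only [hadd, map_add, add_apply]
    abel
  have comp_zero : ∀ i j l m, ∀ S : A, InCorner E i j S → (l ≠ i ∨ j ≠ m) →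
      hE.comp l m S = 0 := by
    rintro i j l m S hS hlm
    apply Subtype.ext
    rw [IsPeircePair.coe_comp, NonUnitalSubalgebra.coe_zero]
    rcases hlm with hli | hjm
    · rw [hS.left_zero hE hli, zero_mul]
    · rw [mul_assoc, hS.right_zero hE hjm, mul_zero]
  have comp_self : ∀ i, ∀ S : A, InCorner E i i S → hE.comp i i S = S := by
    intro i S hS
    apply Subtype.ext
    rw [IsPeircePair.coe_comp, hS.1, hS.2]
  have h_off : ∀ i, ∀ S : A, InCorner E i (!i) S → h S = 0 := by
    intro i S hS
    rw [hh, comp_zero _ _ _ _ S hS (by cases i <;> simp),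
      comp_zero _ _ _ _ S hS (by cases i <;> simp)]
    simp
  have hQ₁ : E false x₁ = x₁ := by simp [hEf, hf₀₁]
  have h_diag : ∀ i, ∀ S : A, InCorner E i i S → E (!i) * M S * E (!i) = h S • E (!i) := by
    intro i S hS
    cases i
    · rw [Bool.not_false, hscalar, hh, comp_self _ S hS, comp_zero _ _ _ _ S hS (by simp)]
      simp
    · rw [hh, comp_self _ S hS, comp_zero _ _ _ _ S hS (by simp), Bool.not_true]
      have hc : ∀ z, E false (M S z) = M S (E false z) :=
        DFunLike.congr_fun (hMlie.commute_of_diag hE hp hMp hS false)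
      have hi : ∀ z, E false (E false z) = E false z := DFunLike.congr_fun (hE.idem false)
      ext y
      -- The compression of `f₁ ⊗ y` sends `x₁` to `E false y`, so commuting with it makes `M S` act
      -- on `E false y` by `f₁ (M S x₁)`.
      have e := DFunLike.congr_fun (hMlie.commute_opposite hE hp hMp hS
        (hE.comp_inCorner false false ⟨_, hA.rankOne_mem f₁ y⟩)) x₁
      simp only [IsPeircePair.coe_comp, mul_apply_eq_comp, hc, hQ₁,
        ContinuousLinearMap.smulRight_apply, hf₁, one_smul, map_smul] at e
      simp [hi, e]
  have h_nonscalar : ∃ C : A, ∀ a b : 𝕜,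
      a • (E false * (C : X →L[𝕜] X) * E false) = b • E false → a = 0 := by
    -- Its compression fixes `x₁` and kills `x₂`, two nonzero vectors of the range of `1 - p`.
    refine ⟨⟨_, hA.rankOne_mem f₁ x₁⟩, fun a b hab => ?_⟩
    have hQ₂ : E false x₂ = x₂ := by simp [hEf, hf₀₂]
    have e1 := DFunLike.congr_fun hab x₁
    have e2 := DFunLike.congr_fun hab x₂
    simp only [smul_apply, mul_apply_eq_comp, hQ₁, hQ₂,
      ContinuousLinearMap.smulRight_apply, hf₁, hf₁₂, one_smul, zero_smul, map_zero,
      smul_zero] at e1 e2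
    have hb : b = 0 := (smul_eq_zero.1 e2.symm).resolve_right hx₂
    rw [hb, zero_smul] at e1
    exact (smul_eq_zero.1 e1).resolve_right hx₁
  have leibniz : ∀ τ : A →+ (X →L[𝕜] X), (∀ S, M S = τ S + h S • 1) →
      ∀ S T : A, τ (S * T) = τ S * T + S * τ T := fun τ hτ =>
    hMlie.leibniz_sub_trace hA.actsPrimely hE hp hMp h_diag h_off h_nonscalar hτ
  obtain ⟨τ, hτ⟩ : ∃ τ : A →+ (X →L[𝕜] X), ∀ S, M S = τ S + h S • 1 :=
    ⟨AddMonoidHom.mk' (fun S => M S - h S • 1) fun S T => by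
      simp only [map_add, add_smul]; abel, fun S => (sub_add_cancel _ _).symm⟩
  have hτder := leibniz τ hτ
  refine ⟨τ - innerDer A D, h, ?_, ?_, ?_⟩
  · intro S T
    simp only [AddMonoidHom.sub_apply, hτder S T, innerDer_apply, NonUnitalSubalgebra.coe_mul]
    noncomm_ring
  · intro S T
    have e := hMlie S T
    rw [hτ, map_sub τ, hτder, hτder, hτ S, hτ T] at e
    -- `M` is a Lie derivation and `τ` a derivation, so their difference `h · 1` vanishes on
    -- commutators.
    have e' : h (S * T - T * S) • (1 : X →L[𝕜] X) = 0 := by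
      rw [← add_left_cancel_iff, e]
      simp only [add_mul, mul_add, smul_mul_assoc, mul_smul_comm, one_mul, mul_one]
      abel
    have e'' := DFunLike.congr_fun e' x₀
    exact (smul_eq_zero.1 e'').resolve_right hx₀
  · intro S
    have e := hτ S
    rw [hM, AddMonoidHom.add_apply, ← eq_sub_iff_add_eq] at e
    rw [e, AddMonoidHom.sub_apply]
    abel

end IsStandardOperatorAlgebra

theorem theorem2p3 {𝕜 X : Type*} [RCLike 𝕜] [NormedAddCommGroup X] [NormedSpace 𝕜 X]
    [CompleteSpace X] (A : NonUnitalSubalgebra 𝕜 (X →L[𝕜] X))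
    (hA : IsStandardOperatorAlgebra A) (ξ : 𝕜) (L : A →+ (X →L[𝕜] X))
    (hL : IsAdditiveXiLieDerivation ξ L) :
    (ξ = 1 → 3 ≤ Module.rank 𝕜 X →
      ∃ (τ : A →+ (X →L[𝕜] X)) (h : A →+ 𝕜),
        IsAdditiveDerivation τ ∧
        (∀ S T : A, h (S * T - T * S) = 0) ∧
        ∀ S : A, L S = τ S + h S • (1 : X →L[𝕜] X)) ∧
    (ξ = -1 → IsAdditiveDerivation L) ∧
    (ξ ≠ 1 → ξ ≠ -1 → Module.rank 𝕜 X ≠ 1 →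
      IsAdditiveDerivation L ∧ ∀ S : A, L (ξ • S) = ξ • L S) := by
  refine ⟨?_, ?_, ?_⟩
  · rintro rfl h3
    exact hA.exists_derivation_add_trace h3 fun S T => by simpa [xiLie] using hL S T
  · rintro rfl
    exact hA.derivation_of_jordan hL
  · intro h1 h2 hX
    refine hA.derivation_of_sq_ne_one hX (fun h => ?_) hL
    rcases eq_or_eq_neg_of_sq_eq_sq ξ 1 (by rw [h, one_pow]) with h | h
    · exact h1 h
    · exact h2 h
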